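/- Let $n\ge 2$ and let $\mathbf W=\{z\in\mathbb R^{n+1}:\langle z-p,\bar N_i\rangle\le 0,\ i=1,2\}$ be a classical wedge, where $\bar N_1,\bar N_2$ are linearly independent unit vectors (the outward unit normals) and $p$ is a point of the edge; its dihedral angle lies in $(0,\pi)$. Let $P_i=\{z\in\mathbf W:\langle z-p,\bar N_i\rangle=0\}$ be its faces, so that $P_1\cap P_2$ is its edge. Let $\vec\theta_0=(\theta_0^1,\theta_0^2)\in(0,\pi)^2$, and let $\mathbf k_0=c_1\bar N_1+c_2\bar N_2$ be the vector determined by $\langle\mathbf k_0,\bar N_i\rangle=\cos\theta_0^i$, $i=1,2$. Let $\Sigma\subset\mathbf W$ be a smooth, compact, embedded $\vec\theta_0$-capillary hypersurface enclosing with $\partial\mathbf W$ a bounded region $\Omega$. This means the following. $\Omega\subset\mathbf W$ is a nonempty bounded open set and $\Sigma=\overline{\partial\Omega\cap\mathring{\mathbf W}}$. Each $x\in\Sigma$ has an open neighbourhood $U$ in $\mathbb R^{n+1}$ with a function $f\in C^\infty(U)$ such that $f(x)=0$, $\nabla f\ne0$ on $U$ and $\Omega\cap U=\{z\in\mathring{\mathbf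 W}\cap U: f(z)<0\}$; the outward unit normal of $\Sigma$ is $\nu=\nabla f/|\nabla f|$. If $x\in\Sigma\cap P_i$, then the contact angle at $x$, that is, the angle between $\nu(x)$ and $-\bar N_i$, equals $\theta_0^i$ (for both $i$ if $x$ is on the edge). Finally, $\Omega$ has no cusp at $x$: there is a vector $v$ with $\langle v,\nu(x)\rangle<0$ and $\langle v,\bar N_i\rangle<0$ for each $i$ with $x\in P_i$ (this is automatic unless $x$ is a point of the edge at which $\Sigma$ is tangent to the edge). If $\Sigma\cap P_1\cap P_2\neq\emptyset$, or if $|\mathbf k_0|<1$, then $\Sigma$ has an elliptic point, i.e. a point $x\in\Sigma$ at which all principal curvatures with respect to the outward unit normal (the eigenvalues of $h(X,Y)=\langle\bar\nabla_X\nu,Y\rangle$ on the tangent space $\nu(x)^\perp$) are positive. -/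

import Mathlib

open Real Set
open scoped ContDiff InnerProductSpace Matrix

noncomputable section

namespace CapillaryWedge

/-- The ambient Euclidean space `ℝⁿ⁺¹`. -/
abbrev Space (n : ℕ) : Type := EuclideanSpace ℝ (Fin (n + 1))

/-- A classical wedge in `ℝⁿ⁺¹`: it is given by a point `apex` of its edge and by the outward unit
normals `N 0`, `N 1` of its two faces. Linear independence of the two unit normals says exactly
that the dihedral angle `α`, `cos α = -⟪N 0, N 1⟫`, lies in the open interval `(0, π)`. -/
structure ClassicalWedge (n : ℕ) where
  apex : Space n
  N : Fin 2 → Space n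
  norm_N : ∀ i, ‖N i‖ = 1
  linearIndependent_N : LinearIndependent ℝ N

namespace ClassicalWedge

variable {n : ℕ} (W : ClassicalWedge n)

/-- The closed region bounded by the two faces. -/
def region : Set (Space n) := {z | ∀ i, ⟪z - W.apex, W.N i⟫_ℝ ≤ 0}

/-- The face `P i` of the wedge, a closed half-hyperplane. -/
def face (i : Fin 2) : Set (Space n) := {z ∈ W.region | ⟪z - W.apex, W.N i⟫_ℝ = 0}

/-- The coefficients `c i` of `k₀ = ∑ i, c i • N i`: the solution of the linear system
`∑ j, ⟪N i, N j⟫ c j = cos (θ i)`, whose matrix is the (invertible) Gram matrix of the normals. -/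
def k₀Coeff (θ : Fin 2 → ℝ) : Fin 2 → ℝ :=
  (Matrix.gram ℝ W.N)⁻¹ *ᵥ fun i => Real.cos (θ i)

/-- The vector `k₀ = ∑ i, c i • N i` of the wedge and the prescribed angles. -/
def k₀ (θ : Fin 2 → ℝ) : Space n := ∑ i, W.k₀Coeff θ i • W.N i

/-- The defining property of `k₀`. -/
theorem inner_k₀ (θ : Fin 2 → ℝ) (i : Fin 2) : ⟪W.k₀ θ, W.N i⟫_ℝ = Real.cos (θ i) := by
  have hdet : IsUnit (Matrix.gram ℝ W.N).det :=
    (Matrix.isUnit_iff_isUnit_det _).1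
      (Matrix.posDef_gram_of_linearIndependent W.linearIndependent_N).isUnit
  have h : Matrix.gram ℝ W.N *ᵥ W.k₀Coeff θ = fun i => Real.cos (θ i) := by
    rw [k₀Coeff, Matrix.mulVec_mulVec, Matrix.mul_nonsing_inv _ hdet, Matrix.one_mulVec]
  have hi := congrFun h i
  simp only [Matrix.mulVec, dotProduct, Matrix.gram_apply] at hi
  rw [← hi, k₀, sum_inner]
  refine Finset.sum_congr rfl fun j _ => ?_
  rw [real_inner_smul_left, real_inner_comm, mul_comm]

end ClassicalWedge

variable {n : ℕ}

/-- `f` is a smooth regular function on the open neighbourhood `U` of `x` that describes `Ω` there: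
inside the wedge, `Ω` is the side `f < 0` of the smooth hypersurface `{f = 0}`. -/
structure IsDefiningFunction (W : ClassicalWedge n) (Ω : Set (Space n)) (x : Space n)
    (U : Set (Space n)) (f : Space n → ℝ) : Prop where
  isOpen : IsOpen U
  mem : x ∈ U
  eq_zero : f x = 0
  smooth : ContDiffOn ℝ ∞ f U
  regular : ∀ z ∈ U, gradient f z ≠ 0
  eq_sublevel : Ω ∩ U = {z ∈ interior W.region ∩ U | f z < 0}

/-- The unit normal field `∇f / |∇f|` of the level sets of `f`. If `f` is a defining function of `Ω`
it points out of `Ω` along `{f = 0}`. -/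
def unitNormal (f : Space n → ℝ) (z : Space n) : Space n :=
  ‖gradient f z‖⁻¹ • gradient f z

/-- The second fundamental form `h(X, Y) = ⟪D_X ν, Y⟫` at `x`, with `ν = ∇f / |∇f|`. -/
def secondFundamentalForm (f : Space n → ℝ) (x X Y : Space n) : ℝ :=
  ⟪fderiv ℝ (unitNormal f) x X, Y⟫_ℝ

/-- `κ` is a principal curvature at `x`, with respect to the outward unit normal of `Ω`: an
eigenvalue, relative to the induced metric, of the second fundamental form on the tangent space
`ν(x)ᗮ` of the hypersurface. -/
def IsPrincipalCurvature (W : ClassicalWedge n) (Ω : Set (Space n)) (x : Space n) (κ : ℝ) : Prop :=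
  ∃ U f, IsDefiningFunction W Ω x U f ∧
    ∃ X : Space n, X ≠ 0 ∧ ⟪X, unitNormal f x⟫_ℝ = 0 ∧
      ∀ Y : Space n, ⟪Y, unitNormal f x⟫_ℝ = 0 →
        secondFundamentalForm f x X Y = κ * ⟪X, Y⟫_ℝ

/-- An elliptic point: all principal curvatures with respect to the outward unit normal are
positive. -/
def IsEllipticPoint (W : ClassicalWedge n) (Ω : Set (Space n)) (x : Space n) : Prop :=
  ∀ κ, IsPrincipalCurvature W Ω x κ → 0 < κ

/-- `S` is a smooth, compact, embedded capillary hypersurface in the wedge `W` with constant contact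
angles `θ 0`, `θ 1`, and `Ω` is the bounded region enclosed by `S` and the boundary of `W`.

* `S` is the closure of the part of the boundary of `Ω` in the interior of `W`; it is compact because
  `Ω` is bounded.
* Around each of its points `S` is smooth up to its boundary: `Ω` is, inside `W`, one side of a smooth
  hypersurface without boundary, `S` being the part of that hypersurface in `W`.
* Wherever `S` meets the face `P i`, the contact angle, i.e. the angle between the outward unit normal
  `ν` of `S` and the inward unit normal `-N i` of the face, is `θ i`. At a point of the edge this is
  required for both faces.
* `Ω` has a corner, not a cusp: some direction points strictly into `Ω` with respect to `S` and to
  all faces through the point. As the angles lie in `(0, π)`, this is automatic away from the edge,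
  and also at points of the edge where `S` is transversal to the edge. -/
structure IsCapillaryHypersurface (W : ClassicalWedge n) (θ : Fin 2 → ℝ) (Ω S : Set (Space n)) :
    Prop where
  isOpen : IsOpen Ω
  nonempty : Ω.Nonempty
  isBounded : Bornology.IsBounded Ω
  subset : Ω ⊆ W.region
  eq_closure : S = closure (frontier Ω ∩ interior W.region)
  smooth_capillary : ∀ x ∈ S, ∃ U f, IsDefiningFunction W Ω x U f ∧
    (∀ i, x ∈ W.face i → InnerProductGeometry.angle (unitNormal f x) (-W.N i) = θ i) ∧
    ∃ v : Space n, ⟪v, unitNormal f x⟫_ℝ < 0 ∧ ∀ i, x ∈ W.face i → ⟪v, W.N i⟫_ℝ < 0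

end CapillaryWedge

end

namespace CapillaryWedge

open Filter Topology Metric

/-! A sphere of radius `r` about `apex + r • k₀` makes exactly the prescribed angles with the faces.
Translate these spheres by `-v`, with `v` pointing strictly into the wedge, and take the smallest
ball of the family containing `closure Ω` (`exists_touching_closedBall`). Such balls exist if `‖k₀‖
< 1`; if `S` meets the edge, then `‖k₀‖ ≤ 1`, and in case of equality the no-cusp vector serves as
`v` after scaling.

The shift makes the angle comparison at the faces strict: at a touching point `x` on a face, `x - c
- r • ν` points strictly into the wedge, and the first order condition then forces it to vanish, a
contradiction. Where `Ω` fills the wedge near `x`, `-k₀` replaces `ν` (`mem_of_touching`). So `x` is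
a point of `S` interior to the wedge, and comparison with the sphere bounds its curvatures below by
`1 / r` (`le_secondFundamentalForm`). -/

/-! ### One-variable sign lemmas -/

theorem eventually_neg_of_hasDerivAt_neg {φ : ℝ → ℝ} {d : ℝ} (h0 : φ 0 = 0)
    (hφ : HasDerivAt φ d 0) (hd : d < 0) : ∀ᶠ t in 𝓝[>] (0 : ℝ), φ t < 0 := by
  have h := eventually_nhdsWithin_sign_eq_of_deriv_neg (f := φ) (x₀ := 0) (by rwa [hφ.deriv]) h0
  filter_upwards [h.filter_mono nhdsWithin_le_nhds, self_mem_nhdsWithin] with t ht ht0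
  rw [zero_sub, sign_neg (neg_lt_zero.2 ht0)] at ht
  exact sign_eq_neg_one_iff.1 ht

/-- The derivative `ψ` is negative just to the right of `0`, so `φ` strictly decreases there. -/
theorem eventually_neg_of_second_deriv_neg {φ ψ : ℝ → ℝ} {d : ℝ} (h0 : φ 0 = 0)
    (hφ : ∀ᶠ t in 𝓝 (0 : ℝ), HasDerivAt φ (ψ t) t) (hψ0 : ψ 0 = 0) (hψ : HasDerivAt ψ d 0)
    (hd : d < 0) : ∀ᶠ t in 𝓝[>] (0 : ℝ), φ t < 0 := by
  have hneg := eventually_neg_of_hasDerivAt_neg hψ0 hψ hd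
  obtain ⟨ε, hε, H⟩ := mem_nhdsGT_iff_exists_Ioo_subset.1 hneg
  obtain ⟨δ, hδ, K⟩ := Metric.eventually_nhds_iff.1 hφ
  filter_upwards [Ioo_mem_nhdsGT (lt_min hε hδ)] with t ht
  have hD : ∀ s ∈ Icc 0 t, HasDerivAt φ (ψ s) s := fun s hs => K (by
    rw [Real.dist_eq, sub_zero, abs_of_nonneg hs.1]
    exact (hs.2.trans_lt ht.2).trans_le (min_le_right _ _))
  have hanti : StrictAntiOn φ (Icc 0 t) := by
    refine strictAntiOn_of_deriv_neg (convex_Icc 0 t)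
      (fun s hs => (hD s hs).continuousAt.continuousWithinAt) fun s hs => ?_
    rw [interior_Icc] at hs
    rw [(hD s (Ioo_subset_Icc_self hs)).deriv]
    exact H ⟨hs.1, (hs.2.trans ht.2).trans_le (min_le_left _ _)⟩
  rw [← h0]
  exact hanti (left_mem_Icc.2 ht.1.le) (right_mem_Icc.2 ht.1.le) ht.1

/-! ### Expanding families of balls -/

section InnerProduct

variable {E : Type*} [NormedAddCommGroup E] [InnerProductSpace ℝ E]

/-- A direction pointing into a subset of a ball from a point of the bounding sphere makes an
angle of at least `π / 2` with the radius. -/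
theorem inner_nonpos_of_eventually_mem_closedBall {c x w : E} {r : ℝ} (hx : ‖x - c‖ = r)
    (h : ∀ᶠ t in 𝓝[>] (0 : ℝ), x + t • w ∈ closedBall c r) : ⟪w, x - c⟫_ℝ ≤ 0 := by
  have key : ∀ᶠ t in 𝓝[>] (0 : ℝ), 2 * ⟪w, x - c⟫_ℝ + t * ‖w‖ ^ 2 ≤ 0 := by
    filter_upwards [h, self_mem_nhdsWithin] with t ht ht0
    have ht0 : 0 < t := ht0
    rw [mem_closedBall, dist_eq_norm, show x + t • w - c = (x - c) + t • w by abel] at ht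
    have h2 : ‖(x - c) + t • w‖ ^ 2 ≤ r ^ 2 := by gcongr
    rw [norm_add_sq_real, hx, norm_smul, real_inner_smul_right, real_inner_comm,
      Real.norm_of_nonneg ht0.le] at h2
    have : t * (2 * ⟪w, x - c⟫_ℝ + t * ‖w‖ ^ 2) ≤ 0 := by linarith
    exact nonpos_of_mul_nonpos_right this ht0
  have hlim : Tendsto (fun t : ℝ => 2 * ⟪w, x - c⟫_ℝ + t * ‖w‖ ^ 2) (𝓝[>] 0)
      (𝓝 (2 * ⟪w, x - c⟫_ℝ + 0 * ‖w‖ ^ 2)) :=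
    ((by fun_prop : Continuous fun t : ℝ => 2 * ⟪w, x - c⟫_ℝ + t * ‖w‖ ^ 2).tendsto 0).mono_left
      nhdsWithin_le_nhds
  linarith [le_of_tendsto hlim key]

/-- The smallest ball of the expanding family `closedBall (y + r • k) r` that contains a compact
set touches that set. -/
theorem exists_touching_closedBall {K : Set E} (hK : IsCompact K) (hne : K.Nonempty) {y k : E}
    (hy : y ∉ K) {R : ℝ} (hR : 0 ≤ R) (hKR : K ⊆ closedBall (y + R • k) R) :
    ∃ r, 0 < r ∧ K ⊆ closedBall (y + r • k) r ∧ ∃ x ∈ K, ‖x - (y + r • k)‖ = r := by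
  set A : Set ℝ := {r | 0 ≤ r ∧ K ⊆ closedBall (y + r • k) r} with hA
  have hAcl : IsClosed A := by
    have : A = Ici 0 ∩ ⋂ z ∈ K, {r | ‖z - (y + r • k)‖ ≤ r} := by
      ext r
      simp [hA, subset_def, dist_eq_norm]
    rw [this]
    exact isClosed_Ici.inter (isClosed_biInter fun z _ =>
      isClosed_le (by fun_prop) continuous_id)
  have hAb : BddBelow A := ⟨0, fun r hr => hr.1⟩
  have hr := hAcl.csInf_mem ⟨R, hR, hKR⟩ hAb
  set r := sInf A
  have hpos : 0 < r := by
    refine hr.1.lt_of_ne fun h0 => ?_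
    obtain ⟨z, hz⟩ := hne
    have := hr.2 hz
    rw [← h0] at this
    simp only [zero_smul, add_zero, closedBall_zero, mem_singleton_iff] at this
    exact hy (this ▸ hz)
  refine ⟨r, hpos, hr.2, ?_⟩
  by_contra! hcon
  have hlt : ∀ z ∈ K, ‖z - (y + r • k)‖ < r := fun z hz =>
    lt_of_le_of_ne (by simpa [dist_eq_norm] using hr.2 hz) (hcon z hz)
  -- Without contact, compactness lets the radius shrink slightly, against minimality of `r`.
  have hev : ∀ᶠ s in 𝓝 r, ∀ z ∈ K, ‖z - (y + s • k)‖ < s :=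
    hK.eventually_forall_of_forall_eventually fun z hz =>
      ((by fun_prop : Continuous fun q : ℝ × E => ‖q.2 - (y + q.1 • k)‖).tendsto
        (r, z)).eventually_lt continuous_fst.continuousAt (hlt z hz)
  obtain ⟨s, ⟨hs, hs0⟩, hsr⟩ := (((hev.and (lt_mem_nhds hpos)).filter_mono
    nhdsWithin_le_nhds).and (self_mem_nhdsWithin (s := Iio r))).exists
  exact absurd (csInf_le hAb ⟨hs0.le, fun z hz => by
    simpa [dist_eq_norm] using (hs z hz).le⟩) (not_le.2 hsr)

/-- Large balls of the family `closedBall (y + r • k) r`, `‖k‖ < 1`, contain any bounded set. -/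
theorem exists_subset_closedBall_of_norm_lt_one {K : Set E} (hK : Bornology.IsBounded K)
    (y : E) {k : E} (hk : ‖k‖ < 1) : ∃ R, 0 ≤ R ∧ K ⊆ closedBall (y + R • k) R := by
  obtain ⟨M, hM⟩ := hK.subset_closedBall y
  have h1 : 0 < 1 - ‖k‖ := sub_pos.2 hk
  refine ⟨|M| / (1 - ‖k‖), by positivity, fun z hz => ?_⟩
  set R := |M| / (1 - ‖k‖)
  have hR0 : 0 ≤ R := by positivity
  have hRM : R * (1 - ‖k‖) = |M| := div_mul_cancel₀ _ h1.ne'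
  have hzM : ‖z - y‖ ≤ |M| := (by simpa [dist_eq_norm] using hM hz : ‖z - y‖ ≤ M).trans
    (le_abs_self M)
  rw [mem_closedBall, dist_eq_norm, ← sub_sub]
  have := norm_sub_le (z - y) (R • k)
  rw [norm_smul, Real.norm_of_nonneg hR0] at this
  linarith

/-- Large balls of the family `closedBall (y + r • k) r`, `‖k‖ = 1`, contain any bounded set at
positive distance from the complement of the half-space `⟪z - y, k⟫ > 0`. -/
theorem exists_subset_closedBall_of_norm_eq_one {K : Set E} (hK : Bornology.IsBounded K)
    {y k : E} (hk : ‖k‖ = 1) (hpos : ∀ z ∈ K, 1 ≤ ⟪z - y, k⟫_ℝ) :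
    ∃ R, 0 ≤ R ∧ K ⊆ closedBall (y + R • k) R := by
  obtain ⟨M, hM⟩ := hK.subset_closedBall y
  -- With `R = M ^ 2` the cross term `-2 * R * ⟪z - y, k⟫` outweighs `‖z - y‖ ^ 2 ≤ M ^ 2`.
  refine ⟨M ^ 2, by positivity, fun z hz => ?_⟩
  have hzM : ‖z - y‖ ≤ M := by simpa [dist_eq_norm] using hM hz
  rw [mem_closedBall, dist_eq_norm, ← sub_sub]
  refine le_of_sq_le_sq ?_ (by positivity)
  rw [norm_sub_sq_real, norm_smul, real_inner_smul_right, hk, mul_one, Real.norm_of_nonneg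
    (by positivity)]
  have h2 : ‖z - y‖ ^ 2 ≤ M ^ 2 := by gcongr
  nlinarith [hpos z hz, sq_nonneg M]

end InnerProduct

variable {n : ℕ}

/-! ### Geometry of the wedge -/

namespace ClassicalWedge

variable (W : ClassicalWedge n)

theorem isClosed_region : IsClosed W.region := by
  simp only [region, ofPred_forall]
  exact isClosed_iInter fun i => isClosed_le (by fun_prop) continuous_const

theorem convex_region : Convex ℝ W.region := by
  intro z hz w hw a b ha hb hab i
  have : a • z + b • w - W.apex = a • (z - W.apex) + b • (w - W.apex) := by
    rw [smul_sub, smul_sub, sub_add_sub_comm, ← add_smul, hab, one_smul]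
  rw [this, inner_add_left, real_inner_smul_left, real_inner_smul_left]
  have h1 := mul_nonpos_of_nonneg_of_nonpos ha (hz i)
  have h2 := mul_nonpos_of_nonneg_of_nonpos hb (hw i)
  linarith

theorem mem_interior_region {z : Space n} (hz : ∀ i, ⟪z - W.apex, W.N i⟫_ℝ < 0) :
    z ∈ interior W.region := by
  refine interior_maximal (s := W.region) (t := {z | ∀ i, ⟪z - W.apex, W.N i⟫_ℝ < 0})
    (fun w hw i => (hw i).le) ?_ hz
  simp only [ofPred_forall]
  exact isOpen_iInter_of_finite fun i => isOpen_lt (by fun_prop) continuous_const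

theorem eventually_mem_interior_region {x w : Space n} (hx : x ∈ W.region)
    (hw : ∀ i, x ∈ W.face i → ⟪w, W.N i⟫_ℝ < 0) :
    ∀ᶠ t in 𝓝[>] (0 : ℝ), x + t • w ∈ interior W.region := by
  have h : ∀ i, ∀ᶠ t in 𝓝[>] (0 : ℝ), ⟪x + t • w - W.apex, W.N i⟫_ℝ < 0 := by
    intro i
    rcases (hx i).lt_or_eq with hlt | heq
    · have hc : Continuous fun t : ℝ => ⟪x + t • w - W.apex, W.N i⟫_ℝ := by fun_prop
      exact ((hc.tendsto 0).eventually_lt_const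
        (by rwa [zero_smul, add_zero])).filter_mono nhdsWithin_le_nhds
    · filter_upwards [self_mem_nhdsWithin] with t ht
      rw [add_sub_right_comm, inner_add_left, heq, real_inner_smul_left, zero_add]
      exact mul_neg_of_pos_of_neg ht (hw i ⟨hx, heq⟩)
  filter_upwards [eventually_all.2 h] with t ht using W.mem_interior_region ht

/-- `-∑ i, N i` points into the wedge from its edge. -/
theorem exists_inner_N_neg : ∃ v : Space n, ∀ i, ⟪v, W.N i⟫_ℝ < 0 := by
  have hlt : -1 < ⟪W.N 0, W.N 1⟫_ℝ := by
    have hle := abs_real_inner_le_norm (W.N 0) (W.N 1)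
    rw [W.norm_N, W.norm_N, mul_one] at hle
    refine (neg_le_of_abs_le hle).lt_of_ne fun heq => ?_
    have h0 : W.N 0 + W.N 1 = 0 := by
      rw [← norm_eq_zero, ← sq_eq_zero_iff, norm_add_sq_real, W.norm_N, W.norm_N, ← heq]
      norm_num
    have := (LinearIndependent.pair_iff.1 (by
      convert W.linearIndependent_N using 1
      ext i; fin_cases i <;> rfl : LinearIndependent ℝ ![W.N 0, W.N 1])) 1 1 (by simpa using h0)
    exact one_ne_zero this.1
  refine ⟨-(W.N 0 + W.N 1), fun i => ?_⟩
  fin_cases i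
  · simp only [Fin.zero_eta, inner_neg_left, inner_add_left, real_inner_self_eq_norm_sq, W.norm_N]
    rw [real_inner_comm]
    linarith
  · simp only [Fin.mk_one, inner_neg_left, inner_add_left, real_inner_self_eq_norm_sq, W.norm_N]
    linarith

/-- The squared norm of `k₀` in terms of any vector making the prescribed angles with the faces. -/
theorem inner_k₀_of_inner_N {θ : Fin 2 → ℝ} {ν : Space n}
    (hν : ∀ i, ⟪ν, W.N i⟫_ℝ = -Real.cos (θ i)) : ⟪ν, W.k₀ θ⟫_ℝ = -‖W.k₀ θ‖ ^ 2 := by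
  rw [← real_inner_self_eq_norm_sq]
  -- Expanding only the right-hand slots turns both sides into `-∑ i, c i * cos (θ i)`.
  nth_rewrite 1 3 [k₀]
  simp only [inner_sum, real_inner_smul_right, hν, W.inner_k₀, mul_neg, Finset.sum_neg_distrib]

end ClassicalWedge

/-! ### Local comparison with a sphere -/

namespace IsDefiningFunction

variable {W : ClassicalWedge n} {Ω U : Set (Space n)} {x : Space n} {f : Space n → ℝ}

theorem contDiffAt (h : IsDefiningFunction W Ω x U f) {z : Space n} (hz : z ∈ U) :
    ContDiffAt ℝ ∞ f z :=
  h.smooth.contDiffAt (h.isOpen.mem_nhds hz)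

theorem differentiableAt (h : IsDefiningFunction W Ω x U f) {z : Space n} (hz : z ∈ U) :
    DifferentiableAt ℝ f z :=
  (h.contDiffAt hz).differentiableAt (by simp)

theorem norm_gradient_pos (h : IsDefiningFunction W Ω x U f) : 0 < ‖gradient f x‖ :=
  norm_pos_iff.2 (h.regular x h.mem)

theorem norm_unitNormal (h : IsDefiningFunction W Ω x U f) : ‖unitNormal f x‖ = 1 := by
  rw [unitNormal, norm_smul, norm_inv, norm_norm, inv_mul_cancel₀ h.norm_gradient_pos.ne']

theorem gradient_eq (h : IsDefiningFunction W Ω x U f) :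
    gradient f x = ‖gradient f x‖ • unitNormal f x := by
  rw [unitNormal, smul_inv_smul₀ h.norm_gradient_pos.ne']

theorem differentiableAt_gradient (h : IsDefiningFunction W Ω x U f) :
    DifferentiableAt ℝ (gradient f) x := by
  have h1 : DifferentiableAt ℝ (fderiv ℝ f) x :=
    ((h.contDiffAt h.mem).fderiv_right (m := 1) (by norm_cast)).differentiableAt (by simp)
  exact (InnerProductSpace.toDual ℝ (Space n)).symm.toContinuousLinearEquiv.differentiableAt.comp x h1

theorem eventually_mem (h : IsDefiningFunction W Ω x U f) (γ : ℝ → Space n)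
    (hγ : ContinuousAt γ 0) (hγ0 : γ 0 = x)
    (hW : ∀ᶠ t in 𝓝[>] (0 : ℝ), γ t ∈ interior W.region)
    (hf : ∀ᶠ t in 𝓝[>] (0 : ℝ), f (γ t) < 0) : ∀ᶠ t in 𝓝[>] (0 : ℝ), γ t ∈ Ω := by
  have hU : ∀ᶠ t in 𝓝[>] (0 : ℝ), γ t ∈ U :=
    (hγ.eventually_mem (h.isOpen.mem_nhds (by rw [hγ0]; exact h.mem))).filter_mono
      nhdsWithin_le_nhds
  filter_upwards [hW, hf, hU] with t h1 h2 h3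
  have : γ t ∈ Ω ∩ U := by
    rw [h.eq_sublevel]
    exact ⟨⟨h1, h3⟩, h2⟩
  exact this.1

theorem eventually_add_smul_mem (h : IsDefiningFunction W Ω x U f) {w : Space n}
    (hx : x ∈ W.region) (hν : ⟪w, unitNormal f x⟫_ℝ < 0)
    (hw : ∀ i, x ∈ W.face i → ⟪w, W.N i⟫_ℝ < 0) :
    ∀ᶠ t in 𝓝[>] (0 : ℝ), x + t • w ∈ Ω := by
  have hγ : HasDerivAt (fun t : ℝ => x + t • w) w 0 := by
    simpa using ((hasDerivAt_id (0 : ℝ)).smul_const w).const_add x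
  have hφ : HasDerivAt (fun t : ℝ => f (x + t • w)) (fderiv ℝ f x w) 0 := by
    exact (h.differentiableAt h.mem).hasFDerivAt.comp_hasDerivAt_of_eq 0 hγ (by simp)
  refine h.eventually_mem _ hγ.continuousAt (by simp) (W.eventually_mem_interior_region hx hw)
    (eventually_neg_of_hasDerivAt_neg (by simpa using h.eq_zero) hφ ?_)
  rw [← inner_gradient_left, h.gradient_eq, real_inner_smul_left, real_inner_comm]
  exact mul_neg_of_pos_of_neg h.norm_gradient_pos hν

/-- Differentiating the factor `‖∇f‖⁻¹` only contributes a multiple of `∇f`, which is orthogonal to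
`X`. -/
theorem secondFundamentalForm_self (h : IsDefiningFunction W Ω x U f) {X : Space n}
    (hX : ⟪X, unitNormal f x⟫_ℝ = 0) :
    secondFundamentalForm f x X X =
      ‖gradient f x‖⁻¹ * ⟪fderiv ℝ (gradient f) x X, X⟫_ℝ := by
  have hd := h.differentiableAt_gradient
  have hne := h.norm_gradient_pos.ne'
  have hinv : DifferentiableAt ℝ (fun z => ‖gradient f z‖⁻¹) x :=
    (hd.norm ℝ (h.regular x h.mem)).inv hne
  have hg : ⟪gradient f x, X⟫_ℝ = 0 := by
    rw [h.gradient_eq, real_inner_smul_left, real_inner_comm, hX, mul_zero]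
  have hder := (hinv.hasFDerivAt.smul hd.hasFDerivAt).fderiv
  rw [secondFundamentalForm, show unitNormal f = fun z => ‖gradient f z‖⁻¹ • gradient f z from rfl]
  erw [hder]
  simp [inner_add_left, real_inner_smul_left, hg]

/-- The first order condition at a touching point of a sphere of radius `r`: if the difference of the
radius vector and `r` times the normal is admissible for the wedge, then it vanishes. -/
theorem sub_eq_smul_unitNormal (h : IsDefiningFunction W Ω x U f) {c : Space n} {r : ℝ}
    (hx : x ∈ W.region) (hxr : ‖x - c‖ = r)
    (hfirst : ∀ w : Space n, (∀ᶠ t in 𝓝[>] (0 : ℝ), x + t • w ∈ Ω) → ⟪w, x - c⟫_ℝ ≤ 0)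
    (hN : ∀ i, x ∈ W.face i → ⟪x - c - r • unitNormal f x, W.N i⟫_ℝ < 0) :
    x - c = r • unitNormal f x := by
  have hν := h.norm_unitNormal
  have hr : 0 ≤ r := hxr ▸ norm_nonneg _
  have hsq : ‖x - c - r • unitNormal f x‖ ^ 2 = 2 * r * (r - ⟪x - c, unitNormal f x⟫_ℝ) := by
    rw [norm_sub_sq_real, norm_smul, hxr, hν, real_inner_smul_right, Real.norm_of_nonneg hr]
    ring
  rcases le_or_gt r ⟪x - c, unitNormal f x⟫_ℝ with hle | hlt
  · rw [← sub_eq_zero, ← norm_eq_zero, ← sq_eq_zero_iff]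
    refine le_antisymm ?_ (sq_nonneg _)
    rw [hsq]
    exact mul_nonpos_of_nonneg_of_nonpos (by positivity) (sub_nonpos.2 hle)
  -- Here `x - c - r • ν` also points strictly inward with respect to `S`, so it is a legitimate
  -- test direction.
  · have hw := hfirst _ (h.eventually_add_smul_mem hx (by
      rw [inner_sub_left, real_inner_smul_left, real_inner_self_eq_norm_sq, hν]
      linarith) hN)
    rw [inner_sub_left, real_inner_self_eq_norm_sq, hxr, real_inner_smul_left,
      real_inner_comm] at hw
    have h0 : r * (r - ⟪x - c, unitNormal f x⟫_ℝ) ≤ 0 := by linarith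
    rw [← sub_eq_zero, ← norm_eq_zero, ← sq_eq_zero_iff]
    refine le_antisymm ?_ (sq_nonneg _)
    rw [hsq]
    linarith

/-- If `Ω` lies in a ball of radius `r` whose boundary sphere it touches, at a point in the interior
of the wedge, then its second fundamental form there is at least that of the sphere. -/
theorem le_secondFundamentalForm (h : IsDefiningFunction W Ω x U f) {c : Space n} {r : ℝ}
    (hr : 0 < r) (hΩ : Ω ⊆ closedBall c r) (hxW : x ∈ interior W.region)
    (hν : x - c = r • unitNormal f x) {X : Space n} (hX : ⟪X, unitNormal f x⟫_ℝ = 0) :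
    r⁻¹ * ‖X‖ ^ 2 ≤ secondFundamentalForm f x X X := by
  rw [h.secondFundamentalForm_self hX]
  have hG := h.norm_gradient_pos
  have hν1 := h.norm_unitNormal
  set G := ‖gradient f x‖
  set ν := unitNormal f x
  set a := ⟪fderiv ℝ (gradient f) x X, X⟫_ℝ
  by_contra! hlt
  obtain ⟨s', hs1, hs2⟩ := exists_between hlt
  -- The parabola `γ` bends inward more than `S`, hence enters `Ω`, but less than the sphere, hence
  -- leaves the ball: `‖γ t - c‖ ^ 2 = r ^ 2 + t ^ 2 * (‖X‖ ^ 2 - s' * r) + s ^ 2 * t ^ 4`.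
  set s := s' / 2 with hs
  let γ : ℝ → Space n := fun t => x + t • X - (s * t ^ 2) • ν
  have hγ0 : γ 0 = x := by simp [γ]
  have hγ : ∀ t, HasDerivAt γ (X - (2 * s * t) • ν) t := by
    intro t
    have h1 := ((hasDerivAt_id t).smul_const X).const_add x
    have h2 := ((hasDerivAt_pow 2 t).const_mul s).smul_const ν
    refine (h1.sub h2).congr_deriv ?_
    rw [one_smul, show s * (((2 : ℕ) : ℝ) * t ^ (2 - 1)) = 2 * s * t by push_cast; ring]
  have hγc : ContinuousAt γ 0 := (hγ 0).continuousAt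
  have hmemU : ∀ᶠ t in 𝓝 (0 : ℝ), γ t ∈ U :=
    hγc.eventually_mem (h.isOpen.mem_nhds (by rw [hγ0]; exact h.mem))
  have hφ : ∀ᶠ t in 𝓝 (0 : ℝ), HasDerivAt (fun t => f (γ t))
      ⟪gradient f (γ t), X - (2 * s * t) • ν⟫_ℝ t := by
    filter_upwards [hmemU] with t ht
    rw [inner_gradient_left]
    exact (h.differentiableAt ht).hasFDerivAt.comp_hasDerivAt t (hγ t)
  have hgX : ⟪gradient f x, X⟫_ℝ = 0 := by
    rw [h.gradient_eq, real_inner_smul_left, real_inner_comm, hX, mul_zero]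
  have hgν : ⟪gradient f x, ν⟫_ℝ = G := by
    rw [h.gradient_eq, real_inner_smul_left, real_inner_self_eq_norm_sq, hν1, one_pow, mul_one]
  have hψ : HasDerivAt (fun t => ⟪gradient f (γ t), X - (2 * s * t) • ν⟫_ℝ) (a - 2 * s * G) 0 := by
    have h1 : HasDerivAt (fun t => gradient f (γ t)) (fderiv ℝ (gradient f) x X) 0 := by
      have := h.differentiableAt_gradient.hasFDerivAt.comp_hasDerivAt_of_eq 0 (hγ 0) hγ0.symm
      simp only [mul_zero, zero_smul, sub_zero] at this
      exact this
    have h2 : HasDerivAt (fun t : ℝ => X - (2 * s * t) • ν) (-((2 * s) • ν)) 0 := by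
      simpa using (((hasDerivAt_id (0 : ℝ)).const_mul (2 * s)).smul_const ν).const_sub X
    have h3 := h1.inner ℝ h2
    refine h3.congr_deriv ?_
    simp only [hγ0, mul_zero, zero_smul, sub_zero, inner_neg_right, real_inner_smul_right, hgν]
    ring
  have hneg : a - 2 * s * G < 0 := by
    have : G⁻¹ * a * G < s' * G := mul_lt_mul_of_pos_right hs1 hG
    rw [mul_right_comm, inv_mul_cancel₀ hG.ne', one_mul] at this
    rw [hs]
    linarith
  have hΩγ := h.eventually_mem γ hγc hγ0
    ((hγc.eventually_mem (isOpen_interior.mem_nhds (by rwa [hγ0]))).filter_mono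
      nhdsWithin_le_nhds)
    (eventually_neg_of_second_deriv_neg (by simpa [hγ0] using h.eq_zero) hφ
      (by simp [hγ0, hgX]) hψ hneg)
  obtain ⟨t, ht, ht0⟩ := (hΩγ.and self_mem_nhdsWithin).exists
  have ht0 : 0 < t := ht0
  have hb := hΩ ht
  rw [mem_closedBall, dist_eq_norm, show γ t - c = (r - s * t ^ 2) • ν + t • X by
    rw [sub_smul, ← hν]; simp only [γ]; abel] at hb
  have h2 : ‖(r - s * t ^ 2) • ν + t • X‖ ^ 2 ≤ r ^ 2 := by gcongr
  rw [norm_add_sq_real, norm_smul, norm_smul, hν1, real_inner_smul_left, real_inner_smul_right,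
    real_inner_comm, hX, mul_one, mul_pow, Real.norm_eq_abs, Real.norm_eq_abs, sq_abs,
    sq_abs] at h2
  have h3 : s' * r < ‖X‖ ^ 2 := by
    have := mul_lt_mul_of_pos_right hs2 hr
    rwa [mul_right_comm, inv_mul_cancel₀ hr.ne', one_mul] at this
  have h4 : t ^ 2 * (‖X‖ ^ 2 - s' * r) ≤ 0 := by
    rw [hs] at h2
    nlinarith [sq_nonneg (s' / 2 * t ^ 2)]
  have h5 : 0 < t ^ 2 * (‖X‖ ^ 2 - s' * r) := by
    have := sub_pos.2 h3
    positivity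
  linarith

end IsDefiningFunction

/-! ### The touching ball and its contact point -/

namespace IsCapillaryHypersurface

variable {W : ClassicalWedge n} {θ : Fin 2 → ℝ} {Ω S : Set (Space n)}

theorem subset_interior (hS : IsCapillaryHypersurface W θ Ω S) : Ω ⊆ interior W.region :=
  interior_maximal hS.subset hS.isOpen

theorem closure_subset (hS : IsCapillaryHypersurface W θ Ω S) : closure Ω ⊆ W.region :=
  closure_minimal hS.subset W.isClosed_region

theorem subset_closure (hS : IsCapillaryHypersurface W θ Ω S) : S ⊆ closure Ω := by
  rw [hS.eq_closure]
  exact closure_minimal (inter_subset_left.trans frontier_subset_closure) isClosed_closure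

/-- Near a point of `closure Ω` away from `S`, `Ω` fills the wedge. -/
theorem eventually_mem_of_notMem (hS : IsCapillaryHypersurface W θ Ω S) {x : Space n}
    (hx : x ∈ closure Ω) (hxS : x ∉ S) : ∀ᶠ z in 𝓝 x, z ∈ interior W.region → z ∈ Ω := by
  have hcl : IsClosed S := hS.eq_closure ▸ isClosed_closure
  obtain ⟨ε, hε, hB⟩ := Metric.isOpen_iff.1 hcl.isOpen_compl x hxS
  -- This convex set meets `Ω` but not its frontier, so it lies in `Ω`.
  have hpre : IsPreconnected (interior W.region ∩ ball x ε) :=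
    (W.convex_region.interior.inter (convex_ball x ε)).isPreconnected
  obtain ⟨y, hyB, hyΩ⟩ := mem_closure_iff_nhds.1 hx _ (ball_mem_nhds x hε)
  have hsub : interior W.region ∩ ball x ε ⊆ Ω := by
    refine hpre.subset_of_closure_inter_subset hS.isOpen
      ⟨y, ⟨hS.subset_interior hyΩ, hyB⟩, hyΩ⟩ fun q hq => ?_
    by_contra hqΩ
    refine hB hq.2.2 ?_
    rw [hS.eq_closure]
    refine _root_.subset_closure ⟨?_, hq.2.1⟩
    rw [hS.isOpen.frontier_eq]
    exact ⟨hq.1, hqΩ⟩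
  filter_upwards [ball_mem_nhds x hε] with z hz hzW using hsub ⟨hzW, hz⟩

/-- The angle condition in terms of inner products. -/
theorem exists_isDefiningFunction (hS : IsCapillaryHypersurface W θ Ω S) {x : Space n}
    (hx : x ∈ S) : ∃ U f, IsDefiningFunction W Ω x U f ∧
      (∀ i, x ∈ W.face i → ⟪unitNormal f x, W.N i⟫_ℝ = -Real.cos (θ i)) ∧
      ∃ v : Space n, ⟪v, unitNormal f x⟫_ℝ < 0 ∧ ∀ i, x ∈ W.face i → ⟪v, W.N i⟫_ℝ < 0 := by
  obtain ⟨U, f, hf, hang, hv⟩ := hS.smooth_capillary x hx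
  refine ⟨U, f, hf, fun i hi => ?_, hv⟩
  rw [← hang i hi, InnerProductGeometry.cos_angle, norm_neg, hf.norm_unitNormal, W.norm_N,
    inner_neg_right]
  simp

/-- If `S` meets the edge, then `‖k₀‖ ≤ 1`, and if moreover `‖k₀‖ = 1`, then `S` is tangent to the
edge there and the absence of cusps yields a direction into the wedge along `k₀`. -/
theorem norm_k₀_lt_or_exists (hS : IsCapillaryHypersurface W θ Ω S) {x : Space n} (hx : x ∈ S)
    (hxe : ∀ i, x ∈ W.face i) : ‖W.k₀ θ‖ < 1 ∨
      ‖W.k₀ θ‖ = 1 ∧ ∃ v : Space n, 0 < ⟪v, W.k₀ θ⟫_ℝ ∧ ∀ i, ⟪v, W.N i⟫_ℝ < 0 := by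
  obtain ⟨U, f, hf, hang, v, hvν, hvN⟩ := hS.exists_isDefiningFunction hx
  have hin := W.inner_k₀_of_inner_N fun i => hang i (hxe i)
  have hν := hf.norm_unitNormal
  have hsq : ‖unitNormal f x + W.k₀ θ‖ ^ 2 = 1 - ‖W.k₀ θ‖ ^ 2 := by
    rw [norm_add_sq_real, hin, hν]
    ring
  have hle : ‖W.k₀ θ‖ ≤ 1 := by
    have := sq_nonneg ‖unitNormal f x + W.k₀ θ‖
    exact (sq_le_one_iff₀ (norm_nonneg _)).1 (by linarith)
  refine hle.lt_or_eq.imp_right fun h1 => ⟨h1, v, ?_, fun i => hvN i (hxe i)⟩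
  rw [h1, one_pow, sub_self, sq_eq_zero_iff, norm_eq_zero] at hsq
  rw [eq_neg_of_add_eq_zero_right hsq, inner_neg_right]
  exact neg_pos.2 hvν

/-- A capillary ball, with centre pushed strictly away from the faces, that contains `Ω` and touches
its closure. -/
theorem exists_touching_closedBall (hS : IsCapillaryHypersurface W θ Ω S)
    (h : (S ∩ (W.face 0 ∩ W.face 1)).Nonempty ∨ ‖W.k₀ θ‖ < 1) :
    ‖W.k₀ θ‖ ≤ 1 ∧ ∃ (c : Space n) (r : ℝ), 0 < r ∧ closure Ω ⊆ closedBall c r ∧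
      (∀ i, r * Real.cos (θ i) < ⟪c - W.apex, W.N i⟫_ℝ) ∧
      ∃ x ∈ closure Ω, ‖x - c‖ = r := by
  have hK : IsCompact (closure Ω) := hS.isBounded.isCompact_closure
  have hcases : ‖W.k₀ θ‖ < 1 ∨
      ‖W.k₀ θ‖ = 1 ∧ ∃ v : Space n, 0 < ⟪v, W.k₀ θ⟫_ℝ ∧ ∀ i, ⟪v, W.N i⟫_ℝ < 0 := by
    rcases h with ⟨x, hx, h0, h1⟩ | h
    · exact hS.norm_k₀_lt_or_exists hx (Fin.forall_fin_two.2 ⟨h0, h1⟩)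
    · exact Or.inl h
  refine ⟨hcases.elim le_of_lt fun h => h.1.le, ?_⟩
  obtain ⟨v, hv, R, hR, hKR⟩ : ∃ v : Space n, (∀ i, ⟪v, W.N i⟫_ℝ < 0) ∧ ∃ R, 0 ≤ R ∧
      closure Ω ⊆ closedBall (W.apex - v + R • W.k₀ θ) R := by
    rcases hcases with hlt | ⟨heq, v, hvk, hvN⟩
    · obtain ⟨v, hv⟩ := W.exists_inner_N_neg
      exact ⟨v, hv, exists_subset_closedBall_of_norm_lt_one hK.isBounded _ hlt⟩
    · obtain ⟨M, hM⟩ := hK.isBounded.subset_closedBall W.apex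
      -- This scaling of `v` moves the base point back far enough that `⟪z - y, k₀⟫ ≥ 1` on `closure
      -- Ω`.
      have hT : 0 < (|M| + 1) / ⟪v, W.k₀ θ⟫_ℝ := by positivity
      refine ⟨((|M| + 1) / ⟪v, W.k₀ θ⟫_ℝ) • v, fun i => ?_,
        exists_subset_closedBall_of_norm_eq_one hK.isBounded heq fun z hz => ?_⟩
      · rw [real_inner_smul_left]
        exact mul_neg_of_pos_of_neg hT (hvN i)
      · rw [sub_sub_eq_add_sub, add_sub_right_comm, inner_add_left, real_inner_smul_left,
          div_mul_cancel₀ _ hvk.ne']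
        have h1 := neg_le_of_abs_le (abs_real_inner_le_norm (z - W.apex) (W.k₀ θ))
        have h2 : ‖z - W.apex‖ ≤ M := by simpa [dist_eq_norm] using hM hz
        rw [heq, mul_one] at h1
        linarith [le_abs_self M]
  have hy : W.apex - v ∉ closure Ω := fun hmem => by
    have := hS.closure_subset hmem 0
    rw [sub_sub_cancel_left, inner_neg_left] at this
    linarith [hv 0]
  obtain ⟨r, hr, hsub, x, hx, hxr⟩ :=
    CapillaryWedge.exists_touching_closedBall hK hS.nonempty.closure hy hR hKR
  refine ⟨_, r, hr, hsub, fun i => ?_, x, hx, hxr⟩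
  rw [show W.apex - v + r • W.k₀ θ - W.apex = r • W.k₀ θ - v by abel, inner_sub_left,
    real_inner_smul_left, W.inner_k₀]
  linarith [hv i]

/-- The touching point lies on `S`, in the interior of the wedge. -/
theorem mem_of_touching (hS : IsCapillaryHypersurface W θ Ω S) (hk : ‖W.k₀ θ‖ ≤ 1)
    {c x : Space n} {r : ℝ} (hr : 0 < r) (hΩ : closure Ω ⊆ closedBall c r)
    (hc : ∀ i, r * Real.cos (θ i) < ⟪c - W.apex, W.N i⟫_ℝ)
    (hx : x ∈ closure Ω) (hxr : ‖x - c‖ = r) : x ∈ S ∧ ∀ i, x ∉ W.face i := by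
  have hxW := hS.closure_subset hx
  have hface : ∀ i, x ∈ W.face i → ⟪x - c, W.N i⟫_ℝ < -(r * Real.cos (θ i)) := by
    intro i hi
    have := hi.2
    rw [← sub_add_sub_cancel x c W.apex, inner_add_left] at this
    linarith [hc i]
  have hfirst : ∀ w : Space n, (∀ᶠ t in 𝓝[>] (0 : ℝ), x + t • w ∈ Ω) → ⟪w, x - c⟫_ℝ ≤ 0 :=
    fun w hw => inner_nonpos_of_eventually_mem_closedBall hxr
      (hw.mono fun t ht => hΩ (_root_.subset_closure ht))
  have hxS : x ∈ S := by
    by_contra hxS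
    have hout : ∀ w : Space n, (∀ i, x ∈ W.face i → ⟪w, W.N i⟫_ℝ < 0) → ⟪w, x - c⟫_ℝ ≤ 0 := by
      intro w hw
      have hlim : Tendsto (fun t : ℝ => x + t • w) (𝓝[>] 0) (𝓝 x) := by
        have hcont : Continuous fun t : ℝ => x + t • w := by fun_prop
        simpa using (hcont.tendsto 0).mono_left nhdsWithin_le_nhds
      refine hfirst w ?_
      filter_upwards [W.eventually_mem_interior_region hxW hw,
        hlim.eventually (hS.eventually_mem_of_notMem hx hxS)] with t h1 h2 using h2 h1
    by_cases hact : ∃ i, x ∈ W.face i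
    · obtain ⟨i, hi⟩ := hact
      have hwN : ∀ j, x ∈ W.face j → ⟪x - c + r • W.k₀ θ, W.N j⟫_ℝ < 0 := fun j hj => by
        rw [inner_add_left, real_inner_smul_left, W.inner_k₀]
        linarith [hface j hj]
      have hw := hout _ hwN
      rw [inner_add_left, real_inner_self_eq_norm_sq, real_inner_smul_left, hxr] at hw
      -- As `‖k₀‖ ≤ 1`, this square is at most twice the quantity bounded in `hw`.
      have hzero : ‖x - c + r • W.k₀ θ‖ ^ 2 ≤ 0 := by
        rw [norm_add_sq_real, norm_smul, hxr, real_inner_smul_right, real_inner_comm,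
          Real.norm_of_nonneg hr.le, mul_pow]
        have : r ^ 2 * ‖W.k₀ θ‖ ^ 2 ≤ r ^ 2 * 1 := by
          gcongr
          exact pow_le_one₀ (norm_nonneg _) hk
        linarith
      have := hwN i hi
      rw [norm_eq_zero.1 (sq_eq_zero_iff.1 (hzero.antisymm (sq_nonneg _))), inner_zero_left] at this
      exact this.false
    -- Off the faces every direction is admissible, even the outward radius.
    · have := hout (x - c) fun i hi => (hact ⟨i, hi⟩).elim
      rw [real_inner_self_eq_norm_sq, hxr] at this
      exact absurd this (not_le.2 (by positivity))
  refine ⟨hxS, fun i hi => ?_⟩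
  obtain ⟨U, f, hf, hang, -⟩ := hS.exists_isDefiningFunction hxS
  have hwN : ∀ j, x ∈ W.face j → ⟪x - c - r • unitNormal f x, W.N j⟫_ℝ < 0 := fun j hj => by
    rw [inner_sub_left, real_inner_smul_left, hang j hj]
    linarith [hface j hj]
  have := hwN i hi
  rw [hf.sub_eq_smul_unitNormal hxW hxr hfirst hwN, sub_self, inner_zero_left] at this
  exact this.false

end IsCapillaryHypersurface

end CapillaryWedge

/-! ### The elliptic point -/

theorem proposition5p3 (n : ℕ) (hn : 2 ≤ n) (W : CapillaryWedge.ClassicalWedge n)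
    (θ : Fin 2 → ℝ) (hθ : ∀ i, θ i ∈ Set.Ioo 0 Real.pi)
    (Ω S : Set (CapillaryWedge.Space n))
    (hS : CapillaryWedge.IsCapillaryHypersurface W θ Ω S)
    (h : (S ∩ (W.face 0 ∩ W.face 1)).Nonempty ∨ ‖W.k₀ θ‖ < 1) :
    ∃ x ∈ S, CapillaryWedge.IsEllipticPoint W Ω x := by
  obtain ⟨hk, c, r, hr, hΩ, hc, x, hx, hxr⟩ := hS.exists_touching_closedBall h
  obtain ⟨hxS, hface⟩ := hS.mem_of_touching hk hr hΩ hc hx hxr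
  refine ⟨x, hxS, ?_⟩
  -- The comparison holds for any defining function at `x`, so the one that comes with `κ` can be
  -- used.
  rintro κ ⟨U, f, hf, X, hX0, hXν, hκ⟩
  have hxW := hS.closure_subset hx
  have hν := hf.sub_eq_smul_unitNormal hxW hxr
    (fun w hw => CapillaryWedge.inner_nonpos_of_eventually_mem_closedBall hxr
      (hw.mono fun t ht => hΩ (subset_closure ht))) (fun i hi => (hface i hi).elim)
  have hle := hf.le_secondFundamentalForm hr (subset_closure.trans hΩ)
    (W.mem_interior_region fun i => (hxW i).lt_of_ne fun heq => hface i ⟨hxW, heq⟩) hν hXν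
  rw [hκ X hXν, real_inner_self_eq_norm_sq] at hle
  have hXpos : 0 < ‖X‖ ^ 2 := by positivity
  exact (inv_pos.2 hr).trans_le (le_of_mul_le_mul_right hle hXpos)
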